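/- **Setting.** All rings are associative with $1$. Let $R\neq 0$ be a ring. A set $S\subseteq R$ is *multiplicative* if $1\in S$, $SS\subseteq S$ and $0\notin S$. It is a *left Ore set* if moreover $Sr\cap Rs\neq\emptyset$ for all $r\in R$, $s\in S$, and a *left denominator set* if moreover $rs=0$ with $r\in R$, $s\in S$ implies $tr=0$ for some $t\in S$. Put $\mathrm{ass}_l(S)=\{r\in R: sr=0\text{ for some }s\in S\}$. For an ideal $\mathfrak a$, $\mathrm{Den}_l(R,\mathfrak a)$ is the set of left denominator sets $S$ of $R$ with $\mathrm{ass}_l(S)=\mathfrak a$, and $S^{-1}R=\{s^{-1}r\}$ is the left localization. Let ${}'\mathcal C_R=\{r\in R: xr=0\Rightarrow x=0\text{ for all }x\in R\}$ be the set of left regular elements of $R$, ${}'S(R)$ the largest left denominator set of $R$ contained in ${}'\mathcal C_R$ (it exists), and ${}'Q(R)={}'S(R)^{-1}R$. Let $K$ be a field of characteristic zero, $n\ge 0$ an integer, $P_n=K[x_1,\dots,x_n]$, $\partial_i=\partial/\partial x_i$ and $H_i=\partial_ix_i\in\mathrm{End}_K(P_n)$. The maps $H_i+j$ $(j\ge 0)$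 are invertible. The Jacobian algebra $\mathbb A_n$ is the subalgebra of $\mathrm{End}_K(P_n)$ generated by $x_i,\partial_i,H_i^{-1}$ $(1\le i\le n)$. Let $\mathfrak p_i$ be the ideal of $\mathbb A_n$ generated by the matrix units $E_{kl}(i)$, $k,l\ge 0$ (the endomorphism $E_{kl}(i)$ sends $x^m$ with $m_i=l$ to the monomial obtained from $x^m$ by replacing $x_i^l$ with $x_i^k$, and sends the other monomials to $0$). Put $\mathfrak a_n=\mathfrak p_1+\cdots+\mathfrak p_n$, $\mathcal A_n=\mathbb A_n/\mathfrak a_n$, with canonical map $\pi:\mathbb A_n\to\mathcal A_n$, and $\overline S=\pi(S)$ for $S\subseteq\mathbb A_n$. Let $\Delta_n\subseteq\mathbb A_n$ be the subalgebra generated by all $\partial_i$, $H_i$ and $(H_i+j)^{-1}$ with $j\ge0$, i.e. the skew polynomial ring $K[H_i^{\pm1},(H_i+1)^{-1},(H_i+2)^{-1},\dots]_{1\le i\le n}[\partial_1,\dots,\partial_n;\tau_1,\dots,\tau_n]$ with $\tau_i(H_j)=H_j+\delta_{ij}$. Put $${}'\Delta_n=\Delta_n\cap{}'S(\mathbb A_n),\qquad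 \widetilde{{}'\Delta_n}=\{c\in\Delta_n:\partial^\alpha c\in{}'S(\mathbb A_n)\text{ for some }\alpha\in\mathbb N^n\},$$ $${}''\Delta_n=\Big({}'S(\mathbb A_n)\cap\big({}'\mathcal C_{\Delta_n+\mathfrak a_n}+\mathfrak a_n\big)\Big)+\mathfrak a_n ,$$ where ${}'\mathcal C_{\Delta_n+\mathfrak a_n}$ is the set of left regular elements of the ring $\Delta_n+\mathfrak a_n$. **Theorem.** Below, $\simeq$ denotes a ring isomorphism commuting with the canonical homomorphisms from $\mathbb A_n$ (in part 6: from $\Delta_n$). 1. ${}'\Delta_n\in\mathrm{Den}_l(\mathbb A_n,\mathfrak a_n)$ and ${}'\Delta_n^{-1}\mathbb A_n\simeq{}'Q(\mathbb A_n)$. The set ${}'\mathcal C_{\mathbb A_n}\cap\Delta_n$ is multiplicative, and ${}'\Delta_n$ is the largest left denominator set of $\mathbb A_n$ contained in it. 2. ${}'\Delta_n+\mathfrak a_n,\ {}'S(\mathbb A_n)+\mathfrak a_n\in\mathrm{Den}_l(\mathbb A_n,\mathfrak a_n)$ and $({}'\Delta_n+\mathfrak a_n)^{-1}\mathbb A_n\simeq({}'S(\mathbb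 A_n)+\mathfrak a_n)^{-1}\mathbb A_n\simeq{}'Q(\mathbb A_n)$. 3. The map $\pi$ is injective on $\Delta_n$ (so ${}'\Delta_n$ is identified with $\overline{{}'\Delta_n}$), $\overline{{}'\Delta_n},\ \overline{{}'\Delta_n+\mathfrak a_n},\ \overline{{}'S(\mathbb A_n)+\mathfrak a_n}\in\mathrm{Den}_l(\mathcal A_n,0)$, and the localization of $\mathcal A_n$ at each of them is $\simeq{}'Q(\mathbb A_n)$. 4. $\widetilde{{}'\Delta_n}\in\mathrm{Den}_l(\mathbb A_n,\mathfrak a_n)$ and $\widetilde{{}'\Delta_n}^{-1}\mathbb A_n\simeq{}'Q(\mathbb A_n)$; moreover $\overline{\widetilde{{}'\Delta_n}}\in\mathrm{Den}_l(\mathcal A_n,0)$ and $\overline{\widetilde{{}'\Delta_n}}^{\,-1}\mathcal A_n\simeq{}'Q(\mathbb A_n)$. 5. $\widetilde{{}'\Delta_n}+\mathfrak a_n\in\mathrm{Den}_l(\mathbb A_n,\mathfrak a_n)$ and $(\widetilde{{}'\Delta_n}+\mathfrak a_n)^{-1}\mathbb A_n\simeq{}'Q(\mathbb A_n)$. 6.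 ${}'\Delta_n\in\mathrm{Den}_l(\Delta_n,0)$ and ${}'\Delta_n^{-1}\Delta_n\simeq{}'Q(\mathbb A_n)$. 7. ${}''\Delta_n\in\mathrm{Den}_l(\mathbb A_n,\mathfrak a_n)$, ${}'\Delta_n\subseteq{}''\Delta_n$ and ${}''\Delta_n^{-1}\mathbb A_n\simeq{}'Q(\mathbb A_n)$. -/

import Mathlib

open scoped Pointwise

noncomputable section

/-! ### Left Ore and left denominator sets, and localization -/

section Denominators

variable {R : Type*} [Ring R]

/-- Multiplicative sets: `1 ∈ S`, `S S ⊆ S` and `0 ∉ S`. -/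
structure IsMultiplicativeSet (S : Set R) : Prop where
  one_mem : (1 : R) ∈ S
  mul_mem : ∀ s ∈ S, ∀ t ∈ S, s * t ∈ S
  zero_notMem : (0 : R) ∉ S

/-- Left Ore sets: multiplicative sets with `S r ∩ R s ≠ ∅` for all `r ∈ R` and `s ∈ S`. -/
structure IsLeftOreSet (S : Set R) : Prop extends IsMultiplicativeSet S where
  ore : ∀ r : R, ∀ s ∈ S, ∃ s' ∈ S, ∃ r' : R, s' * r = r' * s

/-- Left denominator sets: left Ore sets such that `r s = 0` with `s ∈ S` implies `t r = 0` for
some `t ∈ S`. -/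
structure IsLeftDenominatorSet (S : Set R) : Prop extends IsLeftOreSet S where
  reversible : ∀ r : R, ∀ s ∈ S, r * s = 0 → ∃ t ∈ S, t * r = 0

/-- `ass_l(S) = {r | s r = 0 for some s ∈ S}`. -/
def leftAss (S : Set R) : Set R := {r | ∃ s ∈ S, s * r = 0}

/-- `Den_l(R, 𝔞)`, the set of left denominator sets `S` of `R` with `ass_l(S) = 𝔞`. -/
def leftDen (R : Type*) [Ring R] (𝔞 : TwoSidedIdeal R) : Set (Set R) :=
  {S | IsLeftDenominatorSet S ∧ leftAss S = (𝔞 : Set R)}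

namespace IsLeftDenominatorSet

variable {S : Set R}

/-- A left denominator set as a submonoid. -/
def submonoid (h : IsLeftDenominatorSet S) : Submonoid R where
  carrier := S
  one_mem' := h.one_mem
  mul_mem' := fun {a b} ha hb => h.mul_mem a ha b hb

theorem nonempty_oreSet (h : IsLeftDenominatorSet S) :
    Nonempty (OreLocalization.OreSet h.submonoid) := by
  refine OreLocalization.nonempty_oreSet_iff.2 ⟨?_, ?_⟩
  · rintro r₁ r₂ ⟨s, hs⟩ he
    obtain ⟨t, ht, h0⟩ := h.reversible (r₁ - r₂) s hs (by
      rw [sub_mul]; exact sub_eq_zero.2 he)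
    exact ⟨⟨t, ht⟩, by rw [mul_sub] at h0; exact sub_eq_zero.1 h0⟩
  · rintro r ⟨s, hs⟩
    obtain ⟨s', hs', r', he⟩ := h.ore r s hs
    exact ⟨r', ⟨s', hs'⟩, he⟩

instance oreSet (h : IsLeftDenominatorSet S) : OreLocalization.OreSet h.submonoid :=
  h.nonempty_oreSet.some

/-- The left localization `S⁻¹R = {s⁻¹r | s ∈ S, r ∈ R}` at a left denominator set. -/
abbrev Loc (h : IsLeftDenominatorSet S) : Type _ := OreLocalization h.submonoid R

/-- The canonical homomorphism `R → S⁻¹R`. -/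
def toLoc (h : IsLeftDenominatorSet S) : R →+* h.Loc := OreLocalization.numeratorRingHom

end IsLeftDenominatorSet

/-- Two ring homomorphisms with a common source have isomorphic targets, by a ring isomorphism
which commutes with them. -/
def IsoUnder {A B C : Type*} [Ring A] [Ring B] [Ring C] (f : A →+* B) (g : A →+* C) : Prop :=
  ∃ e : B ≃+* C, ∀ a : A, e (f a) = g a

/-! ### The left regular left quotient ring -/

/-- For a subset `T` of `R` (in practice a subring), the set of left regular elements of `T`:
those `t ∈ T` for which `T → R`, `x ↦ x t`, kills no nonzero element. -/
def leftRegularIn (T : Set R) : Set R := {t | t ∈ T ∧ ∀ x ∈ T, x * t = 0 → x = 0}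

/-- The set of left regular elements of `R`, those `r` with `ker (x ↦ x r) = 0`. -/
def leftRegular (R : Type*) [Ring R] : Set R := {r | ∀ x : R, x * r = 0 → x = 0}

/-- The largest left denominator set of `R` among those that consist of left regular elements,
as the union of all of them; see `isGreatest_largestLeftDen`. -/
def largestLeftDen (R : Type*) [Ring R] : Set R :=
  ⋃₀ {S | IsLeftDenominatorSet S ∧ S ⊆ leftRegular R}

theorem isGreatest_largestLeftDen (R : Type*) [Ring R] [Nontrivial R] :
    IsGreatest {S : Set R | IsLeftDenominatorSet S ∧ S ⊆ leftRegular R} (largestLeftDen R) := by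
  have hub : ∀ S ∈ {S : Set R | IsLeftDenominatorSet S ∧ S ⊆ leftRegular R},
      S ⊆ largestLeftDen R := fun S hS => Set.subset_sUnion_of_mem hS
  have hreg : largestLeftDen R ⊆ leftRegular R := Set.sUnion_subset fun S hS => hS.2
  have h1 : IsLeftDenominatorSet ({1} : Set R) :=
    { one_mem := rfl
      mul_mem := by rintro s rfl t rfl; simp
      zero_notMem := by simp
      ore := by rintro r s rfl; exact ⟨1, rfl, r, by simp⟩
      reversible := by rintro r s rfl h; exact ⟨1, rfl, by simpa using h⟩ }
  have h1r : ({1} : Set R) ⊆ leftRegular R := by rintro s rfl x hx; simpa using hx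
  -- The submonoid generated by the union is again such a set.
  let M : Submonoid R := Submonoid.closure (largestLeftDen R)
  have hM : (M : Set R) ⊆ leftRegular R := by
    intro m hm
    induction hm using Submonoid.closure_induction with
    | mem x hx => exact hreg hx
    | one => exact h1r rfl
    | mul x y _ _ hx hy => exact fun z hz => hx z (hy _ (by rw [mul_assoc]; exact hz))
  have hMore : ∀ m ∈ M, ∀ r : R, ∃ s' ∈ M, ∃ r' : R, s' * r = r' * m := by
    intro m hm
    induction hm using Submonoid.closure_induction with
    | mem x hx =>
      intro r
      obtain ⟨S, hS, hxS⟩ := hx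
      obtain ⟨s', hs', r', he⟩ := hS.1.ore r x hxS
      exact ⟨s', Submonoid.subset_closure (hub S hS hs'), r', he⟩
    | one => exact fun r => ⟨1, M.one_mem, r, by simp⟩
    | mul x y _ _ hx hy =>
      intro r
      obtain ⟨s, hs, r', he⟩ := hy r
      obtain ⟨t, ht, r'', he'⟩ := hx r'
      exact ⟨t * s, M.mul_mem ht hs, r'', by rw [mul_assoc, he, ← mul_assoc, he', mul_assoc]⟩
  have hMden : IsLeftDenominatorSet (M : Set R) :=
    { one_mem := M.one_mem
      mul_mem := fun s hs t ht => M.mul_mem hs ht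
      zero_notMem := fun h0 => one_ne_zero (hM h0 (1 : R) (by simp))
      ore := fun r s hs => hMore s hs r
      reversible := fun r s hs h0 => ⟨1, M.one_mem, by rw [hM hs r h0, mul_zero]⟩ }
  have hEq : largestLeftDen R = (M : Set R) :=
    Set.Subset.antisymm Submonoid.subset_closure (hub _ ⟨hMden, hM⟩)
  exact ⟨⟨hEq ▸ hMden, hreg⟩, hub⟩

/-- The left regular left quotient ring of `R`, the localization of `R` at its largest left
denominator set that consists of left regular elements. -/
abbrev LeftRegularQuot (R : Type*) [Ring R] [Nontrivial R] : Type _ :=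
  (isGreatest_largestLeftDen R).1.1.Loc

/-- The canonical homomorphism from `R` to its left regular left quotient ring. -/
def toLeftRegularQuot (R : Type*) [Ring R] [Nontrivial R] : R →+* LeftRegularQuot R :=
  (isGreatest_largestLeftDen R).1.1.toLoc

end Denominators

/-! ### The Jacobian algebra -/

namespace Jacobian

variable (K : Type*) [Field K] (n : ℕ)

/-- The algebra of all `K`-linear endomorphisms of `P_n = K[x_1, …, x_n]`. -/
abbrev EndP : Type _ := Module.End K (MvPolynomial (Fin n) K)

variable {n}

/-- Multiplication by `x_i`. -/
def opX (i : Fin n) : EndP K n := LinearMap.mulLeft K (MvPolynomial.X i)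

/-- The partial derivative `∂_i`. -/
def opD (i : Fin n) : EndP K n := (MvPolynomial.pderiv i).toLinearMap

/-- `H_i = ∂_i x_i`. -/
def opH (i : Fin n) : EndP K n := opD K i * opX K i

/-- The endomorphism `x^m ↦ (m_i + 1 + j)⁻¹ x^m`; it is the inverse of `H_i + j`,
see `opH_add_mul_opHInv` and `opHInv_mul_opH_add`. -/
def opHInv (i : Fin n) (j : ℕ) : EndP K n :=
  (MvPolynomial.basisMonomials (Fin n) K).constr K
    fun m => MvPolynomial.monomial m (((m i : K) + 1 + j)⁻¹)

theorem opX_monomial (i : Fin n) (m : Fin n →₀ ℕ) (c : K) :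
    opX K i (MvPolynomial.monomial m c) =
      MvPolynomial.monomial (m + Finsupp.single i 1) c := by
  simp [opX, MvPolynomial.X, MvPolynomial.monomial_mul, add_comm]

theorem opD_monomial (i : Fin n) (m : Fin n →₀ ℕ) (c : K) :
    opD K i (MvPolynomial.monomial m c) =
      MvPolynomial.monomial (m - Finsupp.single i 1) (c * m i) := by
  simp [opD, MvPolynomial.pderiv_monomial]

theorem opH_monomial (i : Fin n) (m : Fin n →₀ ℕ) (c : K) :
    opH K i (MvPolynomial.monomial m c) = MvPolynomial.monomial m (c * (m i + 1)) := by
  simp [opH, opX_monomial, opD_monomial]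

theorem opHInv_monomial (i : Fin n) (j : ℕ) (m : Fin n →₀ ℕ) (c : K) :
    opHInv K i j (MvPolynomial.monomial m c) =
      MvPolynomial.monomial m (c * ((m i : K) + 1 + j)⁻¹) := by
  have h : MvPolynomial.monomial m c =
      c • MvPolynomial.basisMonomials (Fin n) K m := by
    simp [MvPolynomial.smul_monomial]
  rw [h, map_smul, opHInv, Module.Basis.constr_basis, MvPolynomial.smul_monomial, smul_eq_mul]

variable {K} in
theorem endP_ext {f g : EndP K n}
    (h : ∀ m c, f (MvPolynomial.monomial m c) = g (MvPolynomial.monomial m c)) : f = g :=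
  MvPolynomial.linearMap_ext fun m => LinearMap.ext fun c => h m c

theorem opH_add_mul_opHInv [CharZero K] (i : Fin n) (j : ℕ) :
    (opH K i + (j : EndP K n)) * opHInv K i j = 1 := by
  refine endP_ext fun m c => ?_
  have h : (m i : K) + 1 + j ≠ 0 := by
    have : m i + 1 + j ≠ 0 := by omega
    exact_mod_cast this
  simp only [Module.End.mul_apply, opHInv_monomial, LinearMap.add_apply, opH_monomial,
    Module.End.natCast_apply, Module.End.one_apply, ← map_nsmul, ← map_add]
  congr 1
  rw [nsmul_eq_mul]
  field_simp

theorem opHInv_mul_opH_add [CharZero K] (i : Fin n) (j : ℕ) :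
    opHInv K i j * (opH K i + (j : EndP K n)) = 1 := by
  refine endP_ext fun m c => ?_
  have h : (m i : K) + 1 + j ≠ 0 := by
    have : m i + 1 + j ≠ 0 := by omega
    exact_mod_cast this
  simp only [Module.End.mul_apply, LinearMap.add_apply, opH_monomial,
    Module.End.natCast_apply, Module.End.one_apply, ← map_nsmul, ← map_add, opHInv_monomial]
  congr 1
  rw [nsmul_eq_mul]
  field_simp

variable (n)

/-- The Jacobian algebra `𝔸_n`: the subalgebra of `End_K(P_n)` generated by the Weyl algebra
(i.e. by the `x_i` and the `∂_i`) and the elements `H_i⁻¹`. -/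
def algebra : Subalgebra K (EndP K n) :=
  Algebra.adjoin K
    (Set.range (opX K) ∪ Set.range (opD K) ∪ Set.range fun i : Fin n => opHInv K i 0)

/-- The skew polynomial algebra `K[H_i^{±1}, (H_i+1)⁻¹, (H_i+2)⁻¹, …][∂_1, …, ∂_n; τ_1, …, τ_n]`
realized in `End_K(P_n)`, as the subalgebra generated by the `∂_i`, the `H_i` and the
`(H_i + j)⁻¹` with `j ≥ 0`. -/
def deltaEnd : Subalgebra K (EndP K n) :=
  Algebra.adjoin K
    (Set.range (opD K) ∪ Set.range (opH K) ∪
      Set.range fun p : Fin n × ℕ => opHInv K p.1 p.2)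

/-- `Δ_n` as a subring of `𝔸_n`; see `deltaEnd_le_algebra`. -/
def delta : Subring (algebra K n) := (deltaEnd K n).toSubring.comap (algebra K n).val.toRingHom

variable {n}

/-- `x_i` as an element of `𝔸_n`. -/
def X (i : Fin n) : algebra K n :=
  ⟨opX K i, Algebra.subset_adjoin (Or.inl (Or.inl ⟨i, rfl⟩))⟩

/-- `∂_i` as an element of `𝔸_n`. -/
def D (i : Fin n) : algebra K n :=
  ⟨opD K i, Algebra.subset_adjoin (Or.inl (Or.inr ⟨i, rfl⟩))⟩

/-- `H_i⁻¹` as an element of `𝔸_n`. -/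
def HInv (i : Fin n) : algebra K n :=
  ⟨opHInv K i 0, Algebra.subset_adjoin (Or.inr ⟨i, rfl⟩)⟩

theorem opHInv_mem_algebra [CharZero K] (i : Fin n) (j : ℕ) : opHInv K i j ∈ algebra K n := by
  induction j with
  | zero => exact (HInv K i).2
  | succ j ih =>
    have hj : (j : K) + 1 ≠ 0 := by exact_mod_cast Nat.succ_ne_zero j
    have key : opHInv K i (j + 1) =
        ((j : K) + 1)⁻¹ • (1 - opD K i * opHInv K i j * opX K i) := by
      refine endP_ext fun m c => ?_
      have h : (m i : K) + 1 + ((j : K) + 1) ≠ 0 := by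
        have : m i + 1 + (j + 1) ≠ 0 := by omega
        exact_mod_cast this
      have h' : (m i : K) + 1 + 1 + (j : K) ≠ 0 := by
        have : m i + 1 + 1 + j ≠ 0 := by omega
        exact_mod_cast this
      simp only [LinearMap.smul_apply, LinearMap.sub_apply, Module.End.mul_apply,
        Module.End.one_apply, opX_monomial, opHInv_monomial, opD_monomial,
        Finsupp.add_apply, Finsupp.single_eq_same, add_tsub_cancel_right, ← map_sub,
        MvPolynomial.smul_monomial, smul_eq_mul, Nat.cast_add, Nat.cast_one]
      congr 1
      field_simp
      ring
    rw [key]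
    exact Subalgebra.smul_mem _ (Subalgebra.sub_mem _ (Subalgebra.one_mem _)
      (Subalgebra.mul_mem _ (Subalgebra.mul_mem _ (D K i).2 ih) (X K i).2)) _

variable (n) in
theorem deltaEnd_le_algebra [CharZero K] : deltaEnd K n ≤ algebra K n := by
  refine Algebra.adjoin_le ?_
  rintro _ ((⟨i, rfl⟩ | ⟨i, rfl⟩) | ⟨p, rfl⟩)
  · exact (D K i).2
  · exact Subalgebra.mul_mem _ (D K i).2 (X K i).2
  · exact opHInv_mem_algebra K p.1 p.2

/-- `∂^α = ∂_1^{α_1} ⋯ ∂_n^{α_n}`. -/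
def DPow (α : Fin n → ℕ) : algebra K n := (List.ofFn fun i => D K i ^ α i).prod

/-- The matrix unit `E_{kl}(i)` in the `i`-th tensor factor of `𝔸_n = 𝔸_1 ⊗ ⋯ ⊗ 𝔸_1`, which sends
`x_i^l` to `x_i^k` and the other powers of `x_i` to `0`, see `matrixUnit_monomial`. -/
def matrixUnit (i : Fin n) (k l : ℕ) : algebra K n :=
  ((l.factorial : K)⁻¹) • (X K i ^ k * (1 - X K i * HInv K i * D K i) * D K i ^ l)

theorem opX_pow_monomial (i : Fin n) (k : ℕ) (m : Fin n →₀ ℕ) (c : K) :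
    (opX K i ^ k) (MvPolynomial.monomial m c) =
      MvPolynomial.monomial (m + Finsupp.single i k) c := by
  induction k with
  | zero => simp
  | succ k ih =>
    rw [pow_succ', Module.End.mul_apply, ih, opX_monomial, add_assoc, ← Finsupp.single_add]

theorem opD_pow_monomial (i : Fin n) (l : ℕ) (m : Fin n →₀ ℕ) (c : K) :
    (opD K i ^ l) (MvPolynomial.monomial m c) =
      MvPolynomial.monomial (m - Finsupp.single i l) (c * (m i).descFactorial l) := by
  induction l with
  | zero => simp
  | succ l ih =>
    rw [pow_succ', Module.End.mul_apply, ih, opD_monomial]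
    congr 1
    · rw [tsub_tsub, ← Finsupp.single_add]
    · simp [Nat.descFactorial_succ]; ring

theorem matrixUnit_monomial [CharZero K] (i : Fin n) (k l : ℕ) (m : Fin n →₀ ℕ) (c : K) :
    (matrixUnit K i k l : EndP K n) (MvPolynomial.monomial m c) =
      if m i = l then MvPolynomial.monomial (m.update i k) c else 0 := by
  have key : ∀ (p : Fin n →₀ ℕ) (d : K),
      (1 - opX K i * opHInv K i 0 * opD K i) (MvPolynomial.monomial p d) =
        if p i = 0 then MvPolynomial.monomial p d else 0 := by
    intro p d
    simp only [LinearMap.sub_apply, Module.End.mul_apply, Module.End.one_apply, opD_monomial,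
      opHInv_monomial, opX_monomial]
    split_ifs with h
    · simp [h]
    · have hp : p - Finsupp.single i 1 + Finsupp.single i 1 = p :=
        tsub_add_cancel_of_le (by simpa using Nat.one_le_iff_ne_zero.2 h)
      have hc : ((p i : K)) ≠ 0 := by exact_mod_cast h
      rw [hp, ← map_sub]
      have : (((p - Finsupp.single i 1 : Fin n →₀ ℕ) i : ℕ) : K) + 1 + ((0 : ℕ) : K) = p i := by
        simp only [Finsupp.tsub_apply, Finsupp.single_eq_same]
        rw [Nat.cast_sub (Nat.one_le_iff_ne_zero.2 h)]; simp
      rw [this]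
      simp [hc]
  have e : (matrixUnit K i k l : EndP K n) = ((l.factorial : K)⁻¹) •
      (opX K i ^ k * (1 - opX K i * opHInv K i 0 * opD K i) * opD K i ^ l) := rfl
  rw [e, LinearMap.smul_apply, Module.End.mul_apply, Module.End.mul_apply, opD_pow_monomial, key]
  simp only [Finsupp.tsub_apply, Finsupp.single_eq_same]
  have hl : (l.factorial : K) ≠ 0 := by exact_mod_cast l.factorial_ne_zero
  rcases lt_trichotomy (m i) l with h | h | h
  · rw [if_neg h.ne, Nat.descFactorial_of_lt h]; simp
  · subst h
    rw [if_pos (by simp), if_pos rfl, opX_pow_monomial, MvPolynomial.smul_monomial,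
      Nat.descFactorial_self]
    have hm : m - Finsupp.single i (m i) + Finsupp.single i k = m.update i k := by
      ext j
      by_cases hj : j = i
      · subst hj; simp
      · simp [hj]
    rw [hm, smul_eq_mul]
    congr 1
    field_simp
  · rw [if_neg (by omega), if_neg h.ne', map_zero, smul_zero]

/-- The height one prime `𝔭_i`, the ideal `𝔸_1 ⊗ ⋯ ⊗ F ⊗ ⋯ ⊗ 𝔸_1` of `𝔸_n` generated by the
ideal `F = ⨁ K E_{kl}` of the `i`-th tensor factor. -/
def primeIdeal (i : Fin n) : TwoSidedIdeal (algebra K n) :=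
  TwoSidedIdeal.span (Set.range fun p : ℕ × ℕ => matrixUnit K i p.1 p.2)

variable (n)

/-- `𝔞_n = 𝔭_1 + ⋯ + 𝔭_n`. -/
def maxIdeal : TwoSidedIdeal (algebra K n) := ⨆ i : Fin n, primeIdeal K i

/-- The factor algebra `𝔸_n / 𝔞_n`. -/
abbrev Factor : Type _ := (maxIdeal K n).ringCon.Quotient

/-- The canonical epimorphism `π : 𝔸_n → 𝔸_n / 𝔞_n`. -/
def toFactor : algebra K n →+* Factor K n := (maxIdeal K n).ringCon.mk'

/-- The intersection of `Δ_n` with the largest left denominator set of left regular elements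
of `𝔸_n`. -/
def deltaDen : Set (algebra K n) := (delta K n : Set (algebra K n)) ∩ largestLeftDen (algebra K n)

/-- The set of all `c ∈ Δ_n` such that `∂^α c` lies in the largest left denominator set of left
regular elements of `𝔸_n` for some `α ∈ ℕⁿ`. -/
def deltaSat : Set (algebra K n) :=
  {c | c ∈ delta K n ∧ ∃ α : Fin n → ℕ, DPow K α * c ∈ largestLeftDen (algebra K n)}

/-- The set `(S ∩ (C + 𝔞_n)) + 𝔞_n`, where `S` is the largest left denominator set of left regular
elements of `𝔸_n` and `C` is the set of left regular elements of the ring `Δ_n + 𝔞_n`. -/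
def deltaTwo : Set (algebra K n) :=
  (largestLeftDen (algebra K n) ∩
      (leftRegularIn ((delta K n : Set (algebra K n)) + (maxIdeal K n : Set (algebra K n))) +
        (maxIdeal K n : Set (algebra K n)))) +
    (maxIdeal K n : Set (algebra K n))

/-- `deltaDen` as a subset of the ring `Δ_n`. -/
def deltaDenIn : Set (delta K n) := {d | (d : algebra K n) ∈ deltaDen K n}

end Jacobian

end

/-! ### Recognizing a left localization from a homomorphism. -/

section Localization

variable {R Q : Type*} [Ring R] [Ring Q]

/-! Let `φ` be the canonical map from `𝔸_n` to its left regular left quotient ring. The whole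
theorem reduces to three facts: `ker φ = 𝔞_n`; every element of `𝔞_n` is killed from the left by
some `∂^α`; and every `q` in the quotient ring is `φ(t)⁻¹ φ(r)` with `t` in `deltaDen` and `r ∈
Δ_n`. Given these, any multiplicative set `T` that contains `deltaDen` and is mapped to units by `φ`
is a left denominator set with `ass_l(T) = 𝔞_n` and the same localization
(`exists_mem_leftDen_algebra`). Adding `𝔞_n` to `T` does not change `φ(T)`. Since `φ` embeds `𝔸_n /
𝔞_n` and `Δ_n` into the quotient ring, the statements over these two rings follow in the same way.

The facts rest on the operators `∂^α`. They have right inverses, hence are left regular, and they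
form a left denominator set, hence lie in the largest one. For every `a ∈ 𝔸_n` some `∂^α a` lies in
`Δ_n` (`exists_DPow_mul_mem_delta`), so fractions can be rewritten over `Δ_n`. The ideal `𝔞_n` is
exactly the set of elements killed by some `∂^α` (`mem_maxIdeal_iff`). Finally `Δ_n` is a domain
(`mul_ne_zero_of_mem_deltaEnd`), so left regular denominators kill nothing beyond `𝔞_n`
(`leftAss_largestLeftDen`). -/

theorem IsLeftDenominatorSet.isUnit_toLoc {S : Set R} (h : IsLeftDenominatorSet S) {s : R}
    (hs : s ∈ S) : IsUnit (h.toLoc s) :=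
  OreLocalization.numerator_isUnit (⟨s, hs⟩ : h.submonoid)

theorem IsLeftDenominatorSet.exists_toLoc_mul_eq {S : Set R} (h : IsLeftDenominatorSet S)
    (q : h.Loc) : ∃ s ∈ S, ∃ r, h.toLoc s * q = h.toLoc r := by
  induction q using OreLocalization.ind with
  | _ r s =>
    refine ⟨s, s.2, r, ?_⟩
    change ((s : R) /ₒ (1 : h.submonoid) : h.Loc) * (r /ₒ s) = r /ₒ 1
    exact OreLocalization.mul_cancel

theorem IsLeftDenominatorSet.toLoc_eq_zero_iff {S : Set R} (h : IsLeftDenominatorSet S) {r : R} :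
    h.toLoc r = 0 ↔ r ∈ leftAss S := by
  constructor
  · intro h0
    have h1 : (r /ₒ (1 : h.submonoid) : h.Loc) = 0 /ₒ 1 := by
      rw [← OreLocalization.zero_def]; exact h0
    obtain ⟨u, v, h2, h4⟩ := OreLocalization.oreDiv_eq_iff.1 h1
    rw [smul_zero] at h2
    have h3 : v = (u : R) := by simpa using h4.symm
    exact ⟨u, u.2, by rw [← h3]; exact h2.symm⟩
  · rintro ⟨s, hs, h0⟩
    refine (h.isUnit_toLoc hs).mul_right_eq_zero.1 ?_
    rw [← map_mul, h0, map_zero]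

/-- A ring homomorphism with the defining properties of the left localization at `T` shows that
`T` is a left denominator set, and is isomorphic to the localization at `T`. -/
theorem exists_mem_leftDen_isoUnder [Nontrivial Q] (φ : R →+* Q) {T : Set R}
    {𝔞 : TwoSidedIdeal R} (one_mem : (1 : R) ∈ T) (mul_mem : ∀ s ∈ T, ∀ t ∈ T, s * t ∈ T)
    (isUnit : ∀ t ∈ T, IsUnit (φ t)) (exists_mul_eq : ∀ q, ∃ t ∈ T, ∃ r, φ t * q = φ r)
    (exists_mul_eq_zero : ∀ r, φ r = 0 → ∃ t ∈ T, t * r = 0)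
    (mem_iff : ∀ r, r ∈ 𝔞 ↔ φ r = 0) :
    ∃ h : T ∈ leftDen R 𝔞, IsoUnder h.1.toLoc φ := by
  have hass : leftAss T = (𝔞 : Set R) := by
    ext r
    rw [SetLike.mem_coe, mem_iff]
    refine ⟨?_, exists_mul_eq_zero r⟩
    rintro ⟨t, ht, h0⟩
    refine (isUnit t ht).mul_right_eq_zero.1 ?_
    rw [← map_mul, h0, map_zero]
  have hden : IsLeftDenominatorSet T :=
    { one_mem := one_mem
      mul_mem := mul_mem
      zero_notMem := fun h0 => not_isUnit_zero (M₀ := Q) (by simpa using isUnit 0 h0)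
      ore := fun r s hs => by
        obtain ⟨u, hu⟩ := isUnit s hs
        obtain ⟨t, ht, r', he⟩ := exists_mul_eq (φ r * ↑u⁻¹)
        -- Clearing denominators in `φ(r) φ(s)⁻¹` gives the Ore identity only modulo `ker φ`; a
        -- further factor `t'` from `T` makes it exact.
        obtain ⟨t', ht', h0⟩ := exists_mul_eq_zero (t * r - r' * s) (by
          rw [map_sub, map_mul, map_mul, ← he, ← hu, mul_assoc, mul_assoc, Units.inv_mul, mul_one,
            sub_self])
        refine ⟨t' * t, mul_mem t' ht' t ht, t' * r', ?_⟩
        rw [mul_sub] at h0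
        rw [mul_assoc, mul_assoc]
        exact sub_eq_zero.1 h0
      reversible := fun r s hs h0 => exists_mul_eq_zero r <| by
        refine (isUnit s hs).mul_left_eq_zero.1 ?_
        rw [← map_mul, h0, map_zero] }
  refine ⟨⟨hden, hass⟩, ?_⟩
  choose u hu using isUnit
  let fS : hden.submonoid →* Qˣ := Units.liftRight (φ.toMonoidHom.comp hden.submonoid.subtype)
    (fun s => u s s.2) (fun s => hu s s.2)
  have hfS : ∀ s : hden.submonoid, φ s = fS s := fun s => (hu s s.2).symm
  let e : hden.Loc →+* Q := OreLocalization.universalHom φ fS hfS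
  have he : ∀ r, e (hden.toLoc r) = φ r := fun r =>
    OreLocalization.universalHom_commutes φ fS hfS
  have hbij : Function.Bijective e := by
    constructor
    · refine (injective_iff_map_eq_zero e).2 fun q hq => ?_
      obtain ⟨s, hs, r, hr⟩ := hden.exists_toLoc_mul_eq q
      refine (hden.isUnit_toLoc hs).mul_right_eq_zero.1 ?_
      rw [hr, hden.toLoc_eq_zero_iff, hass, SetLike.mem_coe, mem_iff, ← he, ← hr, map_mul, hq,
        mul_zero]
    · intro q
      obtain ⟨t, ht, r, hr⟩ := exists_mul_eq q
      obtain ⟨v, hv⟩ := hden.isUnit_toLoc ht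
      refine ⟨↑v⁻¹ * hden.toLoc r, ?_⟩
      have hut : IsUnit (φ t) := ⟨u t ht, hu t ht⟩
      refine hut.mul_left_cancel ?_
      rw [hr, ← he, ← he, ← map_mul, ← hv, Units.mul_inv_cancel_left]
  exact ⟨RingEquiv.ofBijective e hbij, he⟩

/-- The case of an injective homomorphism in `exists_mem_leftDen_isoUnder`. -/
theorem exists_mem_leftDen_bot_isoUnder [Nontrivial Q] (φ : R →+* Q) {T : Set R}
    (one_mem : (1 : R) ∈ T) (mul_mem : ∀ s ∈ T, ∀ t ∈ T, s * t ∈ T)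
    (isUnit : ∀ t ∈ T, IsUnit (φ t)) (exists_mul_eq : ∀ q, ∃ t ∈ T, ∃ r, φ t * q = φ r)
    (injective : Function.Injective φ) :
    ∃ h : T ∈ leftDen R ⊥, IsoUnder h.1.toLoc φ :=
  exists_mem_leftDen_isoUnder φ one_mem mul_mem isUnit exists_mul_eq
    (fun r hr => ⟨1, one_mem, by rw [one_mul, (map_eq_zero_iff φ injective).1 hr]⟩)
    fun r => (TwoSidedIdeal.mem_bot _).trans (map_eq_zero_iff φ injective).symm

theorem map_add_eq_of_map_eq_zero (φ : R →+* Q) {x y : R} (h : φ y = 0) : φ (x + y) = φ x := by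
  rw [map_add, h, add_zero]

theorem map_eq_iff_map_sub_eq_zero (φ : R →+* Q) {x y : R} : φ x = φ y ↔ φ (x - y) = 0 := by
  rw [map_sub, sub_eq_zero]

end Localization

/-! ### `Δ_n` is a domain: operators `∑ u_α(H) ∂^α` with rational coefficients. -/

noncomputable section

namespace Jacobian

open MvPolynomial

variable (K : Type*) [Field K] {n : ℕ}

/-- The endomorphism `∂^α` on monomials. -/
def opDPow (α : Fin n →₀ ℕ) : EndP K n :=
  (basisMonomials (Fin n) K).constr K
    fun m => monomial (m - α) (∏ i, ((m i).descFactorial (α i) : K))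

theorem opDPow_monomial (α m : Fin n →₀ ℕ) (c : K) :
    opDPow K α (monomial m c) =
      monomial (m - α) (c * ∏ i, ((m i).descFactorial (α i) : K)) := by
  have h : monomial m c = c • basisMonomials (Fin n) K m := by simp [smul_monomial]
  rw [h, map_smul, opDPow, Module.Basis.constr_basis, smul_monomial, smul_eq_mul]

theorem opDPow_zero : opDPow K (0 : Fin n →₀ ℕ) = 1 :=
  endP_ext fun m c => by simp [opDPow_monomial]

theorem opDPow_add (α β : Fin n →₀ ℕ) : opDPow K (α + β) = opDPow K α * opDPow K β := by
  refine endP_ext fun m c => ?_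
  rw [Module.End.mul_apply, opDPow_monomial, opDPow_monomial, opDPow_monomial, tsub_tsub,
    add_comm β α, mul_assoc, ← Finset.prod_mul_distrib]
  congr 2
  refine Finset.prod_congr rfl fun i _ => ?_
  have h := Nat.descFactorial_mul_descFactorial (n := m i) (Nat.le_add_left (β i) (α i))
  rw [Nat.add_sub_cancel] at h
  rw [Finsupp.add_apply, Finsupp.tsub_apply, ← h]
  push_cast
  ring

theorem opDPow_single (i : Fin n) (a : ℕ) : opDPow K (Finsupp.single i a) = opD K i ^ a := by
  refine endP_ext fun m c => ?_
  rw [opDPow_monomial, opD_pow_monomial, Finset.prod_eq_single i]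
  · simp
  · intro j _ hj
    simp [Finsupp.single_eq_of_ne hj]
  · simp

/-- Since `opDPow` is a homomorphism from the commutative monoid `ℕⁿ`, the ordered product of the
`∂_i^{α_i}` can be evaluated there. -/
theorem coe_DPow (α : Fin n →₀ ℕ) : (DPow K α : EndP K n) = opDPow K α := by
  let φ : Multiplicative (Fin n →₀ ℕ) →* EndP K n :=
    { toFun := fun a => opDPow K a.toAdd
      map_one' := opDPow_zero K
      map_mul' := fun a b => opDPow_add K _ _ }
  have h1 : (DPow K α : EndP K n) =
      (List.ofFn fun i => φ (Multiplicative.ofAdd (Finsupp.single i (α i)))).prod := by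
    change (algebra K n).val (DPow K α) = _
    rw [DPow, map_list_prod, List.map_ofFn]
    congr 2
    funext i
    simp only [φ, MonoidHom.coe_mk, OneHom.coe_mk, toAdd_ofAdd, opDPow_single]
    rfl
  have h2 : (List.ofFn fun i => φ (Multiplicative.ofAdd (Finsupp.single i (α i)))).prod =
      φ (∏ i, Multiplicative.ofAdd (Finsupp.single i (α i))) := by
    rw [← List.prod_ofFn, map_list_prod, List.map_ofFn]
    rfl
  rw [h1, h2, ← ofAdd_sum, Finsupp.univ_sum_single]
  rfl

/-- The diagonal endomorphisms of `P_n` with respect to the basis of monomials. -/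
def diag : ((Fin n →₀ ℕ) → K) →ₐ[K] EndP K n :=
  AlgHom.ofLinearMap
    { toFun := fun u => (basisMonomials (Fin n) K).constr K fun m => monomial m (u m)
      map_add' := fun u v => (basisMonomials (Fin n) K).ext fun m => by
        simp only [LinearMap.add_apply, Module.Basis.constr_basis, Pi.add_apply, map_add]
      map_smul' := fun a u => (basisMonomials (Fin n) K).ext fun m => by
        simp only [LinearMap.smul_apply, Module.Basis.constr_basis, Pi.smul_apply,
          smul_monomial, RingHom.id_apply] }
    ((basisMonomials (Fin n) K).ext fun m => by
      simp only [LinearMap.coe_mk, AddHom.coe_mk, Module.Basis.constr_basis, Pi.one_apply,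
        Module.End.one_apply]
      rw [coe_basisMonomials])
    fun u v => (basisMonomials (Fin n) K).ext fun m => by
      have h : ∀ c : K, monomial m c = c • basisMonomials (Fin n) K m := fun c => by
        simp [smul_monomial]
      simp only [LinearMap.coe_mk, AddHom.coe_mk, Module.End.mul_apply,
        Module.Basis.constr_basis, h, map_smul, smul_smul, Pi.mul_apply, mul_comm]

theorem diag_monomial (u : (Fin n →₀ ℕ) → K) (m : Fin n →₀ ℕ) (c : K) :
    diag K u (monomial m c) = monomial m (c * u m) := by
  have h : monomial m c = c • basisMonomials (Fin n) K m := by simp [smul_monomial]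
  have h' : diag K u (basisMonomials (Fin n) K m) = monomial m (u m) :=
    Module.Basis.constr_basis _ K _ _
  rw [h, map_smul, h', smul_monomial, smul_eq_mul]

theorem opH_eq_diag (i : Fin n) : opH K i = diag K fun m => (m i : K) + 1 :=
  endP_ext fun m c => by rw [opH_monomial, diag_monomial]

theorem opHInv_eq_diag (i : Fin n) (j : ℕ) :
    opHInv K i j = diag K fun m => ((m i : K) + 1 + j)⁻¹ :=
  endP_ext fun m c => by rw [opHInv_monomial, diag_monomial]

/-- This makes the truncated subtraction `m - α` harmless: whenever it truncates, the coefficient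
vanishes. -/
theorem prod_descFactorial_eq_zero {α m : Fin n →₀ ℕ} (h : ¬ α ≤ m) :
    ∏ i, ((m i).descFactorial (α i) : K) = 0 := by
  obtain ⟨i, hi⟩ := not_forall.1 (mt Finsupp.le_def.2 h)
  refine Finset.prod_eq_zero (Finset.mem_univ i) ?_
  rw [Nat.descFactorial_of_lt (not_le.1 hi), Nat.cast_zero]

/-- The skew commutation rule: moving `∂^α` to the right past a function of the exponents shifts
that function by `α`. -/
theorem opDPow_mul_diag (α : Fin n →₀ ℕ) (u : (Fin n →₀ ℕ) → K) :
    opDPow K α * diag K u = diag K (fun m => u (m + α)) * opDPow K α := by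
  refine endP_ext fun m c => ?_
  simp only [Module.End.mul_apply, opDPow_monomial, diag_monomial]
  by_cases h : α ≤ m
  · rw [tsub_add_cancel_of_le h]
    congr 1
    ring
  · simp [prod_descFactorial_eq_zero K h]

variable (n) in
/-- The functions on `ℕⁿ` which are quotients of polynomials by polynomials without zeros. -/
def regularFun : Subalgebra K ((Fin n →₀ ℕ) → K) where
  carrier := {u | ∃ p q : MvPolynomial (Fin n) K, ∀ m : Fin n →₀ ℕ,
    eval (fun i => (m i : K)) q ≠ 0 ∧
      eval (fun i => (m i : K)) q * u m = eval (fun i => (m i : K)) p}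
  mul_mem' := by
    rintro u v ⟨p, q, h⟩ ⟨p', q', h'⟩
    refine ⟨p * p', q * q', fun m => ⟨?_, ?_⟩⟩
    · rw [map_mul]; exact mul_ne_zero (h m).1 (h' m).1
    · rw [map_mul, map_mul, ← (h m).2, ← (h' m).2, Pi.mul_apply]; ring
  add_mem' := by
    rintro u v ⟨p, q, h⟩ ⟨p', q', h'⟩
    refine ⟨p * q' + q * p', q * q', fun m => ⟨?_, ?_⟩⟩
    · rw [map_mul]; exact mul_ne_zero (h m).1 (h' m).1
    · rw [map_add, map_mul, map_mul, map_mul, ← (h m).2, ← (h' m).2, Pi.add_apply]; ring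
  algebraMap_mem' c := ⟨C c, 1, fun m => by simp [Pi.algebraMap_apply]⟩

theorem exists_eval_add (p : MvPolynomial (Fin n) K) (α : Fin n →₀ ℕ) :
    ∃ p' : MvPolynomial (Fin n) K, ∀ m : Fin n →₀ ℕ,
      eval (fun i => (m i : K)) p' = eval (fun i => ((m + α) i : K)) p := by
  refine ⟨bind₁ (fun i => MvPolynomial.X i + C (α i : K)) p, fun m => ?_⟩
  rw [eval, eval₂Hom_bind₁]
  congr 2
  funext i
  simp

/-- The shift `u ↦ u(· + α)`. -/
def shift (α : Fin n →₀ ℕ) (u : regularFun K n) : regularFun K n :=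
  ⟨fun m => u.1 (m + α), by
    obtain ⟨p, q, h⟩ := u.2
    obtain ⟨p', hp⟩ := exists_eval_add K p α
    obtain ⟨q', hq⟩ := exists_eval_add K q α
    exact ⟨p', q', fun m => by rw [hp, hq]; exact h (m + α)⟩⟩

variable {K}

/-- In characteristic zero `α + ℕⁿ` is a product of infinite subsets of `K`, so it is Zariski dense.
-/
theorem eq_zero_of_eval_add_eq_zero [CharZero K] {p : MvPolynomial (Fin n) K} (α : Fin n →₀ ℕ)
    (h : ∀ m : Fin n →₀ ℕ, eval (fun i => ((m + α) i : K)) p = 0) : p = 0 := by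
  refine funext_set (fun i => Set.range fun k : ℕ => ((k + α i : ℕ) : K))
    (fun i => Set.infinite_range_of_injective fun a b hab => ?_) fun x hx => ?_
  · simpa using hab
  · choose m hm using fun i => hx i (Set.mem_univ i)
    rw [map_zero, ← h (Finsupp.equivFunOnFinite.symm m)]
    congr 2
    funext i
    rw [← hm i]
    simp

/-- The denominators have no zeros on `ℕⁿ`, so the question passes to the numerators, which live in
the domain of polynomials. -/
theorem eq_zero_or_eq_zero_of_mul_shift_eq_zero [CharZero K] {α : Fin n →₀ ℕ}
    {u v : regularFun K n} (h : u * shift K α v = 0) : u = 0 ∨ v = 0 := by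
  obtain ⟨p, q, hpq⟩ := u.2
  obtain ⟨p', q', hpq'⟩ := v.2
  obtain ⟨p'', hp''⟩ := exists_eval_add K p' α
  have h0 : p * p'' = 0 := by
    refine eq_zero_of_eval_add_eq_zero 0 fun m => ?_
    have hm : u.1 m * v.1 (m + α) = 0 := congrFun (congrArg Subtype.val h) m
    rw [add_zero, map_mul, hp'', ← (hpq m).2, ← (hpq' (m + α)).2, mul_mul_mul_comm, hm, mul_zero]
  rcases mul_eq_zero.1 h0 with h1 | h1
  · left
    refine Subtype.ext (funext fun m => (mul_eq_zero.1 ?_).resolve_left (hpq m).1)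
    rw [(hpq m).2, h1, map_zero]
  · right
    have h2 : p' = 0 := eq_zero_of_eval_add_eq_zero α fun m => by rw [← hp'', h1, map_zero]
    refine Subtype.ext (funext fun m => (mul_eq_zero.1 ?_).resolve_left (hpq' m).1)
    rw [(hpq' m).2, h2, map_zero]

variable (K n) in
/-- The operator `∑ u_α(H) ∂^α` with given coefficients. -/
def opSum : ((Fin n →₀ ℕ) →₀ regularFun K n) →ₗ[K] EndP K n :=
  Finsupp.lsum K fun α =>
    LinearMap.mulRight K (opDPow K α) ∘ₗ (diag K).toLinearMap ∘ₗ (regularFun K n).val.toLinearMap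

theorem opSum_single (α : Fin n →₀ ℕ) (u : regularFun K n) :
    opSum K n (Finsupp.single α u) = diag K u * opDPow K α := by
  simp [opSum]

/-- Only the term with `α = γ` can send `x^(m+γ)` to a multiple of `x^m`. The descending factorials
that appear are nonzero in characteristic zero, so an operator determines its coefficients. -/
theorem coeff_opSum (F : (Fin n →₀ ℕ) →₀ regularFun K n) (m γ : Fin n →₀ ℕ) :
    coeff m (opSum K n F (monomial (m + γ) 1)) =
      (F γ : (Fin n →₀ ℕ) → K) m * ∏ i, (((m + γ) i).descFactorial (γ i) : K) := by
  induction F using Finsupp.induction_linear with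
  | zero => simp
  | add F G hF hG => simp [hF, hG, add_mul]
  | single α u =>
    rw [opSum_single, Module.End.mul_apply, opDPow_monomial, diag_monomial, coeff_monomial]
    by_cases hα : α = γ
    · subst hα
      simp [mul_comm]
    · rw [Finsupp.single_eq_of_ne (Ne.symm hα)]
      by_cases hle : α ≤ m + γ
      · rw [if_neg]
        · simp
        · intro he
          refine hα (add_left_cancel (a := m) ?_)
          rw [← tsub_add_cancel_of_le hle, he]
      · rw [prod_descFactorial_eq_zero K hle]
        simp

/-- The coefficients of a product of two operators. -/
def mulCoeff (F G : (Fin n →₀ ℕ) →₀ regularFun K n) : (Fin n →₀ ℕ) →₀ regularFun K n :=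
  ∑ α ∈ F.support, ∑ β ∈ G.support, Finsupp.single (α + β) (F α * shift K α (G β))

theorem opSum_mulCoeff (F G : (Fin n →₀ ℕ) →₀ regularFun K n) :
    opSum K n (mulCoeff F G) = opSum K n F * opSum K n G := by
  have h : ∀ F : (Fin n →₀ ℕ) →₀ regularFun K n,
      opSum K n F = ∑ α ∈ F.support, diag K (F α) * opDPow K α := fun F => by
    conv_lhs => rw [← F.sum_single, Finsupp.sum, map_sum]
    simp only [opSum_single]
  rw [h F, h G, Finset.sum_mul_sum, mulCoeff, map_sum]
  refine Finset.sum_congr rfl fun α _ => ?_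
  rw [map_sum]
  refine Finset.sum_congr rfl fun β _ => ?_
  rw [opSum_single, Subalgebra.coe_mul, map_mul, opDPow_add, mul_assoc, mul_assoc,
    ← mul_assoc (opDPow K α), opDPow_mul_diag, mul_assoc]
  rfl

/-- The monoid `ℕⁿ` has unique sums: some `α + β` with `α`, `β` in the two supports arises from no
other pair. The coefficient of the product there is the single term `F α * shift K α (G β)`, which
is nonzero. -/
theorem opSum_mul_ne_zero [CharZero K] {F G : (Fin n →₀ ℕ) →₀ regularFun K n} (hF : F ≠ 0)
    (hG : G ≠ 0) : opSum K n F * opSum K n G ≠ 0 := by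
  obtain ⟨α, hα, β, hβ, hu⟩ := UniqueSums.uniqueAdd_of_nonempty
    (Finsupp.support_nonempty_iff.2 hF) (Finsupp.support_nonempty_iff.2 hG)
  have hc : mulCoeff F G (α + β) = F α * shift K α (G β) := by
    rw [mulCoeff, Finsupp.finsetSum_apply, Finset.sum_eq_single_of_mem α hα,
      Finsupp.finsetSum_apply, Finset.sum_eq_single_of_mem β hβ, Finsupp.single_eq_same]
    · intro b hb hne
      exact Finsupp.single_eq_of_ne fun he => hne (hu hα hb he.symm).2
    · intro a ha hne
      rw [Finsupp.finsetSum_apply]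
      exact Finset.sum_eq_zero fun b hb =>
        Finsupp.single_eq_of_ne fun he => hne (hu ha hb he.symm).1
  intro h0
  rw [← opSum_mulCoeff] at h0
  have h1 : F α * shift K α (G β) = 0 := by
    refine Subtype.ext (funext fun m => ?_)
    have h2 := coeff_opSum (mulCoeff F G) m (α + β)
    rw [h0, LinearMap.zero_apply, coeff_zero, hc] at h2
    refine (mul_eq_zero.1 h2.symm).resolve_right (Finset.prod_ne_zero_iff.2 fun i _ => ?_)
    rw [Nat.cast_ne_zero, Ne, Nat.descFactorial_eq_zero_iff_lt]
    simp
  rcases eq_zero_or_eq_zero_of_mul_shift_eq_zero h1 with h | h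
  · exact (Finsupp.mem_support_iff.1 hα) h
  · exact (Finsupp.mem_support_iff.1 hβ) h

theorem exists_opSum_eq_of_mem_deltaEnd [CharZero K] {d : EndP K n} (hd : d ∈ deltaEnd K n) :
    ∃ F, opSum K n F = d := by
  have hone : ∀ i : Fin n, ∀ c : K, (fun m : Fin n →₀ ℕ => (m i : K) + 1 + c) ∈ regularFun K n :=
    fun i c => ⟨MvPolynomial.X i + 1 + C c, 1, fun m => by simp⟩
  have hdiag : ∀ u ∈ regularFun K n, ∃ F, opSum K n F = diag K u := fun u hu =>
    ⟨Finsupp.single 0 ⟨u, hu⟩, by rw [opSum_single, opDPow_zero, mul_one]⟩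
  induction hd using Algebra.adjoin_induction with
  | mem x hx =>
    rcases hx with (⟨i, rfl⟩ | ⟨i, rfl⟩) | ⟨⟨i, j⟩, rfl⟩
    · refine ⟨Finsupp.single (Finsupp.single i 1) 1, ?_⟩
      rw [opSum_single, opDPow_single, Subalgebra.coe_one, map_one, one_mul, pow_one]
    · rw [opH_eq_diag]
      exact hdiag _ (by simpa using hone i 0)
    · dsimp only
      rw [opHInv_eq_diag]
      refine hdiag _ ⟨1, MvPolynomial.X i + 1 + C (j : K), fun m => ?_⟩
      have h : (m i : K) + 1 + j ≠ 0 := by 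
        have : m i + 1 + j ≠ 0 := by omega
        exact_mod_cast this
      simp [h]
  | algebraMap r =>
    rw [← (diag K).commutes]
    exact hdiag _ (Subalgebra.algebraMap_mem _ r)
  | add x y _ _ hx hy =>
    obtain ⟨F, rfl⟩ := hx
    obtain ⟨G, rfl⟩ := hy
    exact ⟨F + G, map_add _ _ _⟩
  | mul x y _ _ hx hy =>
    obtain ⟨F, rfl⟩ := hx
    obtain ⟨G, rfl⟩ := hy
    exact ⟨mulCoeff F G, opSum_mulCoeff F G⟩

theorem mul_ne_zero_of_mem_deltaEnd [CharZero K] {d e : EndP K n} (hd : d ∈ deltaEnd K n)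
    (he : e ∈ deltaEnd K n) (hd0 : d ≠ 0) (he0 : e ≠ 0) : d * e ≠ 0 := by
  obtain ⟨F, rfl⟩ := exists_opSum_eq_of_mem_deltaEnd hd
  obtain ⟨G, rfl⟩ := exists_opSum_eq_of_mem_deltaEnd he
  exact opSum_mul_ne_zero (fun h => hd0 (by rw [h, map_zero])) fun h => he0 (by rw [h, map_zero])

end Jacobian

end

/-! ### The operators `∂^α` inside `𝔸_n` and the ideal `𝔞_n`. -/

noncomputable section

theorem eq_one_sub_mul_mul_add {R : Type*} [Ring R] (u v r : R) :
    r = (1 - u * v) * r + u * (v * r) := by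
  rw [sub_mul, one_mul, mul_assoc, sub_add_cancel]

theorem mul_neg_eq_zero_of_mul_eq_zero {R : Type*} [Ring R] {x y : R} (h : x * y = 0) :
    x * -y = 0 := by
  rw [mul_neg, h, neg_zero]

namespace Jacobian

variable {K : Type*} [Field K] {n : ℕ}

theorem DPow_zero : DPow K (0 : Fin n → ℕ) = 1 :=
  Subtype.ext <| by
    have h := coe_DPow K (0 : Fin n →₀ ℕ)
    rw [opDPow_zero] at h
    exact h

theorem DPow_add (α β : Fin n → ℕ) : DPow K (α + β) = DPow K α * DPow K β := by
  obtain ⟨α, rfl⟩ := Finsupp.equivFunOnFinite.surjective α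
  obtain ⟨β, rfl⟩ := Finsupp.equivFunOnFinite.surjective β
  refine Subtype.ext ?_
  have h := coe_DPow K (α + β)
  rw [opDPow_add, ← coe_DPow, ← coe_DPow] at h
  exact h

theorem DPow_mul_comm (α β : Fin n → ℕ) : DPow K α * DPow K β = DPow K β * DPow K α := by
  rw [← DPow_add, add_comm, DPow_add]

theorem DPow_single (i : Fin n) (a : ℕ) : DPow K (Pi.single i a) = D K i ^ a := by
  refine Subtype.ext ?_
  have h := coe_DPow K (Finsupp.single i a)
  rw [opDPow_single, Finsupp.single_eq_pi_single] at h
  exact h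

theorem mem_delta_iff {d : algebra K n} : d ∈ delta K n ↔ (d : EndP K n) ∈ deltaEnd K n := Iff.rfl

theorem D_mem_delta (i : Fin n) : D K i ∈ delta K n :=
  mem_delta_iff.2 (Algebra.subset_adjoin (Or.inl (Or.inl ⟨i, rfl⟩)))

theorem DPow_mem_delta (α : Fin n → ℕ) : DPow K α ∈ delta K n :=
  Subring.list_prod_mem _ fun x hx => by
    obtain ⟨i, rfl⟩ := (List.mem_ofFn' _ _).1 hx
    exact Subring.pow_mem _ (D_mem_delta i) _

/-- Modulo `𝔞_n` the element `∂_i` has the left inverse `x_i H_i⁻¹`, because `1 - x_i H_i⁻¹ ∂_i` is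
the matrix unit `E_{00}(i)`. -/
theorem D_mul_mem_maxIdeal_iff {i : Fin n} {r : algebra K n} :
    D K i * r ∈ maxIdeal K n ↔ r ∈ maxIdeal K n := by
  refine ⟨fun h => ?_, fun h => TwoSidedIdeal.mul_mem_left _ _ _ h⟩
  have h1 : matrixUnit K i 0 0 ∈ maxIdeal K n :=
    le_iSup (primeIdeal K) i (TwoSidedIdeal.subset_span ⟨(0, 0), rfl⟩)
  have h2 : r = matrixUnit K i 0 0 * r + X K i * HInv K i * (D K i * r) := by
    simp only [matrixUnit, Nat.factorial_zero, Nat.cast_one, inv_one, one_smul, pow_zero, one_mul,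
      mul_one]
    exact eq_one_sub_mul_mul_add (X K i * HInv K i) (D K i) r
  rw [h2]
  exact add_mem (TwoSidedIdeal.mul_mem_right _ _ _ h1) (TwoSidedIdeal.mul_mem_left _ _ _ h)

theorem DPow_mul_mem_maxIdeal_iff {α : Fin n → ℕ} {r : algebra K n} :
    DPow K α * r ∈ maxIdeal K n ↔ r ∈ maxIdeal K n := by
  have h : ∀ l : List (algebra K n), (∀ x ∈ l, ∀ r, x * r ∈ maxIdeal K n ↔ r ∈ maxIdeal K n) →
      (l.prod * r ∈ maxIdeal K n ↔ r ∈ maxIdeal K n) := by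
    intro l
    induction l with
    | nil => simp
    | cons x l ih =>
      intro hl
      rw [List.prod_cons, mul_assoc, hl x List.mem_cons_self,
        ih fun y hy => hl y (List.mem_cons_of_mem _ hy)]
  refine h _ fun x hx r => ?_
  obtain ⟨i, rfl⟩ := (List.mem_ofFn' _ _).1 hx
  dsimp only
  clear hx
  induction α i with
  | zero => simp
  | succ a ih => rw [pow_succ', mul_assoc, D_mul_mem_maxIdeal_iff, ih]

variable [CharZero K]

theorem D_mul_X_mul_HInv (i : Fin n) : D K i * (X K i * HInv K i) = 1 := by
  have h := opH_add_mul_opHInv K i 0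
  rw [Nat.cast_zero, add_zero] at h
  exact Subtype.ext ((mul_assoc _ _ _).symm.trans h)

theorem exists_D_pow_mul_eq_one (i : Fin n) (a : ℕ) : ∃ b, D K i ^ a * b = 1 := by
  induction a with
  | zero => exact ⟨1, by simp⟩
  | succ a ih =>
    obtain ⟨b, hb⟩ := ih
    refine ⟨X K i * HInv K i * b, ?_⟩
    rw [pow_succ, mul_assoc, ← mul_assoc (D K i), D_mul_X_mul_HInv, one_mul, hb]

theorem exists_DPow_mul_eq_one (α : Fin n → ℕ) : ∃ b, DPow K α * b = 1 := by
  have h : ∀ l : List (algebra K n), (∀ x ∈ l, ∃ b, x * b = 1) → ∃ b, l.prod * b = 1 := by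
    intro l
    induction l with
    | nil => exact fun _ => ⟨1, by simp⟩
    | cons x l ih =>
      intro hl
      obtain ⟨b, hb⟩ := ih fun y hy => hl y (List.mem_cons_of_mem _ hy)
      obtain ⟨c, hc⟩ := hl x List.mem_cons_self
      refine ⟨b * c, ?_⟩
      rw [List.prod_cons, mul_assoc, ← mul_assoc l.prod, hb, one_mul, hc]
  refine h _ fun x hx => ?_
  obtain ⟨i, rfl⟩ := (List.mem_ofFn' _ _).1 hx
  exact exists_D_pow_mul_eq_one i _

theorem DPow_ne_zero (α : Fin n → ℕ) : DPow K α ≠ 0 := fun h => by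
  obtain ⟨b, hb⟩ := exists_DPow_mul_eq_one (K := K) α
  rw [h, zero_mul] at hb
  exact zero_ne_one hb

theorem eq_zero_of_mul_DPow_eq_zero {α : Fin n → ℕ} {x : algebra K n} (h : x * DPow K α = 0) :
    x = 0 := by
  obtain ⟨b, hb⟩ := exists_DPow_mul_eq_one (K := K) α
  rw [← mul_one x, ← hb, ← mul_assoc, h, zero_mul]

theorem eq_zero_or_eq_zero_of_mem_delta {d e : algebra K n} (hd : d ∈ delta K n)
    (he : e ∈ delta K n) (h : d * e = 0) : d = 0 ∨ e = 0 := by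
  by_contra! hne
  exact mul_ne_zero_of_mem_deltaEnd (mem_delta_iff.1 hd) (mem_delta_iff.1 he)
    (fun h0 => hne.1 (Subtype.ext h0)) (fun h0 => hne.2 (Subtype.ext h0)) (congrArg Subtype.val h)

/-- On generators `∂^α` shifts `H_i` to `H_i + α_i` and `(H_i + j)⁻¹` to `(H_i + j + α_i)⁻¹`; both
stay in `Δ_n` because it contains the inverses for all `j ≥ 0`. -/
theorem exists_DPow_mul_eq_mul_DPow (α : Fin n → ℕ) {d : algebra K n} (hd : d ∈ delta K n) :
    ∃ d' ∈ delta K n, DPow K α * d = d' * DPow K α := by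
  obtain ⟨α, rfl⟩ := Finsupp.equivFunOnFinite.surjective α
  have key : ∀ x ∈ deltaEnd K n, ∃ y ∈ deltaEnd K n, opDPow K α * x = y * opDPow K α := by
    intro x hx
    induction hx using Algebra.adjoin_induction with
    | mem x hx =>
      rcases hx with (⟨i, rfl⟩ | ⟨i, rfl⟩) | ⟨⟨i, j⟩, rfl⟩
      · refine ⟨opD K i, Algebra.subset_adjoin (Or.inl (Or.inl ⟨i, rfl⟩)), ?_⟩
        rw [← pow_one (opD K i), ← opDPow_single, ← opDPow_add, add_comm, opDPow_add]
      · refine ⟨opH K i + algebraMap K _ (α i : K), Subalgebra.add_mem _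
          (Algebra.subset_adjoin (Or.inl (Or.inr ⟨i, rfl⟩))) (Subalgebra.algebraMap_mem _ _), ?_⟩
        rw [opH_eq_diag, opDPow_mul_diag, ← (diag K).commutes, ← map_add]
        congr 2
        funext m
        simp
        ring
      · refine ⟨opHInv K i (j + α i), Algebra.subset_adjoin (Or.inr ⟨(i, j + α i), rfl⟩), ?_⟩
        dsimp only
        rw [opHInv_eq_diag, opDPow_mul_diag, opHInv_eq_diag]
        congr 2
        funext m
        rw [Finsupp.add_apply]
        push_cast
        ring
    | algebraMap r => exact ⟨_, Subalgebra.algebraMap_mem _ r, (Algebra.commutes r _).symm⟩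
    | add x y _ _ hx hy =>
      obtain ⟨x', hx', h⟩ := hx
      obtain ⟨y', hy', h'⟩ := hy
      exact ⟨x' + y', Subalgebra.add_mem _ hx' hy', by rw [mul_add, add_mul, h, h']⟩
    | mul x y _ _ hx hy =>
      obtain ⟨x', hx', h⟩ := hx
      obtain ⟨y', hy', h'⟩ := hy
      exact ⟨x' * y', Subalgebra.mul_mem _ hx' hy', by
        rw [← mul_assoc, h, mul_assoc, h', mul_assoc]⟩
  obtain ⟨y, hy, h⟩ := key d (mem_delta_iff.1 hd)
  refine ⟨⟨y, deltaEnd_le_algebra K n hy⟩, mem_delta_iff.2 hy, Subtype.ext ?_⟩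
  change (DPow K α : EndP K n) * d = y * (DPow K α : EndP K n)
  rw [coe_DPow, h]

/-- Among the generators of `𝔸_n` only `x_i` needs a factor, and `∂_i x_i = H_i`. In a product `x
y`, once `∂^α x` is in `Δ_n`, the power needed for `y` is moved past it. -/
theorem exists_DPow_mul_mem_delta (a : algebra K n) : ∃ α, DPow K α * a ∈ delta K n := by
  obtain ⟨a, ha⟩ := a
  induction ha using Algebra.adjoin_induction with
  | mem x hx =>
    rcases hx with (⟨i, rfl⟩ | ⟨i, rfl⟩) | ⟨i, rfl⟩
    · refine ⟨Pi.single i 1, ?_⟩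
      rw [DPow_single, pow_one]
      exact mem_delta_iff.2 (Algebra.subset_adjoin (Or.inl (Or.inr ⟨i, rfl⟩)))
    · exact ⟨0, by rw [DPow_zero, one_mul]; exact D_mem_delta i⟩
    · refine ⟨0, ?_⟩
      rw [DPow_zero, one_mul]
      exact mem_delta_iff.2 (Algebra.subset_adjoin (Or.inr ⟨(i, 0), rfl⟩))
  | algebraMap r =>
    refine ⟨0, ?_⟩
    rw [DPow_zero, one_mul]
    exact mem_delta_iff.2 (Subalgebra.algebraMap_mem _ r)
  | add x y hx' hy' hx hy =>
    obtain ⟨α, hα⟩ := hx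
    obtain ⟨β, hβ⟩ := hy
    refine ⟨α + β, ?_⟩
    have h : DPow K (α + β) * (⟨x + y, add_mem hx' hy'⟩ : algebra K n) =
        DPow K β * (DPow K α * ⟨x, hx'⟩) + DPow K α * (DPow K β * ⟨y, hy'⟩) := by
      rw [← mul_assoc, ← mul_assoc, DPow_mul_comm β, ← mul_add, DPow_add]
      rfl
    rw [h]
    exact add_mem (mul_mem (DPow_mem_delta β) hα) (mul_mem (DPow_mem_delta α) hβ)
  | mul x y hx' hy' hx hy =>
    obtain ⟨α, hα⟩ := hx
    obtain ⟨β, hβ⟩ := hy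
    obtain ⟨d, hd, h⟩ := exists_DPow_mul_eq_mul_DPow β hα
    refine ⟨β + α, ?_⟩
    have h' : DPow K (β + α) * (⟨x * y, mul_mem hx' hy'⟩ : algebra K n) =
        DPow K β * (DPow K α * ⟨x, hx'⟩) * ⟨y, hy'⟩ := by
      rw [DPow_add, mul_assoc, mul_assoc, mul_assoc]
      rfl
    rw [h', h, mul_assoc]
    exact mul_mem hd hβ

theorem exists_DPow_mul_eq_mul (α : Fin n → ℕ) (r : algebra K n) :
    ∃ β r', DPow K β * r = r' * DPow K α := by
  obtain ⟨β, hβ⟩ := exists_DPow_mul_mem_delta r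
  obtain ⟨d, -, h⟩ := exists_DPow_mul_eq_mul_DPow α hβ
  exact ⟨α + β, d, by rw [DPow_add, mul_assoc, h]⟩

/-- The elements killed by some `∂^α` form an ideal by the Ore condition for the `∂^α`, and it
contains all matrix units. Conversely `∂^α r = 0` lies in `𝔞_n`, and `∂^α` cancels modulo `𝔞_n`. -/
theorem mem_maxIdeal_iff {r : algebra K n} : r ∈ maxIdeal K n ↔ ∃ α, DPow K α * r = 0 := by
  constructor
  · let I : TwoSidedIdeal (algebra K n) := TwoSidedIdeal.mk' {r | ∃ α, DPow K α * r = 0}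
      ⟨0, mul_zero _⟩
      (by
        rintro x y ⟨α, hα⟩ ⟨β, hβ⟩
        refine ⟨α + β, ?_⟩
        rw [mul_add, DPow_add, mul_assoc _ _ y, hβ, DPow_mul_comm, mul_assoc, hα, mul_zero,
          mul_zero, add_zero])
      (by
        rintro x ⟨α, hα⟩
        exact ⟨α, mul_neg_eq_zero_of_mul_eq_zero hα⟩)
      (by
        rintro x y ⟨α, hα⟩
        obtain ⟨β, x', h⟩ := exists_DPow_mul_eq_mul α x
        exact ⟨β, by rw [← mul_assoc, h, mul_assoc, hα, mul_zero]⟩)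
      (by
        rintro x y ⟨α, hα⟩
        exact ⟨α, by rw [← mul_assoc, hα, zero_mul]⟩)
    have hI : maxIdeal K n ≤ I := by
      refine iSup_le fun i => TwoSidedIdeal.span_le.2 ?_
      rintro _ ⟨⟨k, l⟩, rfl⟩
      rw [TwoSidedIdeal.coe_mk']
      -- The image of `E_{kl}(i)` has degree at most `k` in `x_i`, so `∂_i^(k+1)` kills it.
      refine ⟨Pi.single i (k + 1), ?_⟩
      rw [DPow_single]
      refine Subtype.ext (endP_ext fun m c => ?_)
      change (opD K i ^ (k + 1)) ((matrixUnit K i k l : EndP K n) _) = 0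
      rw [matrixUnit_monomial]
      split_ifs
      · rw [opD_pow_monomial]
        simp
      · exact map_zero _
    exact fun h => (TwoSidedIdeal.mem_mk' {r | ∃ α, DPow K α * r = 0} _ _ _ _ _ r).1 (hI h)
  · rintro ⟨α, h⟩
    rw [← DPow_mul_mem_maxIdeal_iff (α := α), h]
    exact zero_mem _

theorem DPow_mem_largestLeftDen (α : Fin n → ℕ) : DPow K α ∈ largestLeftDen (algebra K n) := by
  have hreg : Set.range (DPow K (n := n)) ⊆ leftRegular (algebra K n) := by
    rintro _ ⟨α, rfl⟩ x h
    exact eq_zero_of_mul_DPow_eq_zero h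
  refine Set.mem_sUnion_of_mem (Set.mem_range_self α) ⟨?_, hreg⟩
  exact
    { one_mem := ⟨0, DPow_zero⟩
      mul_mem := by
        rintro _ ⟨α, rfl⟩ _ ⟨β, rfl⟩
        exact ⟨α + β, DPow_add α β⟩
      zero_notMem := by
        rintro ⟨α, h⟩
        exact DPow_ne_zero α h
      ore := by
        rintro r _ ⟨α, rfl⟩
        obtain ⟨β, r', h⟩ := exists_DPow_mul_eq_mul α r
        exact ⟨_, ⟨β, rfl⟩, r', h⟩
      reversible := by
        rintro r s hs h
        exact ⟨1, ⟨0, DPow_zero⟩, by rw [hreg hs r h, mul_zero]⟩ }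

/-- If `s r = 0`, multiplying by powers of `∂` turns this into a relation `d (∂^β r) = 0` inside the
domain `Δ_n`. Here `d = 0` would give `∂^γ s = 0` for some `γ`, against left regularity of `s`. -/
theorem leftAss_largestLeftDen :
    leftAss (largestLeftDen (algebra K n)) = (maxIdeal K n : Set (algebra K n)) := by
  ext r
  rw [SetLike.mem_coe]
  constructor
  · rintro ⟨s, hs, h⟩
    obtain ⟨α, hα⟩ := exists_DPow_mul_mem_delta s
    obtain ⟨β, hβ⟩ := exists_DPow_mul_mem_delta r
    obtain ⟨d, hd, he⟩ := exists_DPow_mul_eq_mul_DPow β hα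
    have h0 : d * (DPow K β * r) = 0 := by
      rw [← mul_assoc, ← he, mul_assoc, mul_assoc, h, mul_zero, mul_zero]
    rcases eq_zero_or_eq_zero_of_mem_delta hd hβ h0 with h1 | h1
    · rw [h1, zero_mul, ← mul_assoc, ← DPow_add] at he
      exact absurd ((isGreatest_largestLeftDen (algebra K n)).1.2 hs _ he) (DPow_ne_zero _)
    · exact mem_maxIdeal_iff.2 ⟨β, h1⟩
  · intro h
    obtain ⟨α, hα⟩ := mem_maxIdeal_iff.1 h
    exact ⟨_, DPow_mem_largestLeftDen α, hα⟩

/-- This is `Δ_n ∩ 𝔞_n = 0`: an element of the domain `Δ_n` killed by the nonzero `∂^α ∈ Δ_n` is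
zero. -/
theorem eq_of_sub_mem_maxIdeal {c d : algebra K n} (hc : c ∈ delta K n) (hd : d ∈ delta K n)
    (h : c - d ∈ maxIdeal K n) : c = d := by
  obtain ⟨α, hα⟩ := mem_maxIdeal_iff.1 h
  exact sub_eq_zero.1 ((eq_zero_or_eq_zero_of_mem_delta (DPow_mem_delta α)
    (sub_mem hc hd) hα).resolve_left (DPow_ne_zero α))

end Jacobian

end

/-! ### Multiplicative sets with the left regular left quotient ring as localization. -/

noncomputable section

namespace Jacobian

variable {K : Type*} [Field K] {n : ℕ}

theorem isUnit_toLeftRegularQuot {s : algebra K n} (hs : s ∈ largestLeftDen (algebra K n)) :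
    IsUnit (toLeftRegularQuot (algebra K n) s) :=
  (isGreatest_largestLeftDen (algebra K n)).1.1.isUnit_toLoc hs

theorem mul_mem_largestLeftDen {s t : algebra K n} (hs : s ∈ largestLeftDen (algebra K n))
    (ht : t ∈ largestLeftDen (algebra K n)) : s * t ∈ largestLeftDen (algebra K n) :=
  (isGreatest_largestLeftDen (algebra K n)).1.1.mul_mem s hs t ht

theorem toFactor_surjective : Function.Surjective (toFactor K n) := RingCon.mk'_surjective _

theorem toFactor_eq_iff {a b : algebra K n} :
    toFactor K n a = toFactor K n b ↔ a - b ∈ maxIdeal K n :=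
  (RingCon.eq _).trans (TwoSidedIdeal.rel_iff _ _ _)

theorem subset_add_maxIdeal (T : Set (algebra K n)) :
    T ⊆ T + (maxIdeal K n : Set (algebra K n)) := fun t ht =>
  ⟨t, ht, 0, (maxIdeal K n).zero_mem, add_zero t⟩

theorem mul_mem_add_maxIdeal {T : Set (algebra K n)} (mul_mem : ∀ s ∈ T, ∀ t ∈ T, s * t ∈ T) :
    ∀ s ∈ T + (maxIdeal K n : Set (algebra K n)), ∀ t ∈ T + (maxIdeal K n : Set (algebra K n)),
      s * t ∈ T + (maxIdeal K n : Set (algebra K n)) := by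
  rintro _ ⟨s, hs, a, ha, rfl⟩ _ ⟨t, ht, b, hb, rfl⟩
  refine ⟨s * t, mul_mem s hs t ht, s * b + a * (t + b), add_mem
    (TwoSidedIdeal.mul_mem_left _ _ _ hb) (TwoSidedIdeal.mul_mem_right _ _ _ ha), ?_⟩
  dsimp only
  rw [add_mul, mul_add s, add_assoc]

theorem deltaDen_subset_deltaSat : deltaDen K n ⊆ deltaSat K n := fun s hs =>
  ⟨hs.1, 0, by rw [DPow_zero, one_mul]; exact hs.2⟩

theorem mul_mem_deltaDen {s t : algebra K n} (hs : s ∈ deltaDen K n) (ht : t ∈ deltaDen K n) :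
    s * t ∈ deltaDen K n :=
  ⟨mul_mem hs.1 ht.1, mul_mem_largestLeftDen hs.2 ht.2⟩

theorem deltaDen_subset_deltaTwo : deltaDen K n ⊆ deltaTwo K n := fun _ hs =>
  subset_add_maxIdeal _ ⟨hs.2, subset_add_maxIdeal _ ⟨subset_add_maxIdeal _ hs.1,
    fun x _ hx => (isGreatest_largestLeftDen (algebra K n)).1.2 hs.2 x hx⟩⟩

theorem mul_mem_deltaTwo : ∀ s ∈ deltaTwo K n, ∀ t ∈ deltaTwo K n, s * t ∈ deltaTwo K n := by
  refine mul_mem_add_maxIdeal fun s hs t ht => ⟨mul_mem_largestLeftDen hs.1 ht.1,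
    mul_mem_add_maxIdeal (fun c hc d hd => ?_) s hs.2 t ht.2⟩
  have hmul := mul_mem_add_maxIdeal (K := K) (n := n) (T := delta K n) fun _ h _ h' => mul_mem h h'
  exact ⟨hmul c hc.1 d hd.1, fun x hx h0 =>
    hc.2 x hx (hd.2 _ (hmul x hx c hc.1) (by rw [mul_assoc, h0]))⟩

variable [CharZero K]

theorem toLeftRegularQuot_eq_zero_iff {r : algebra K n} :
    toLeftRegularQuot (algebra K n) r = 0 ↔ r ∈ maxIdeal K n := by
  rw [toLeftRegularQuot, IsLeftDenominatorSet.toLoc_eq_zero_iff, leftAss_largestLeftDen,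
    SetLike.mem_coe]

theorem toLeftRegularQuot_eq_iff {r s : algebra K n} :
    toLeftRegularQuot (algebra K n) r = toLeftRegularQuot (algebra K n) s ↔
      r - s ∈ maxIdeal K n :=
  (map_eq_iff_map_sub_eq_zero _).trans toLeftRegularQuot_eq_zero_iff

instance : Nontrivial (LeftRegularQuot (algebra K n)) := by
  refine ⟨⟨toLeftRegularQuot (algebra K n) 1, 0, fun h => ?_⟩⟩
  obtain ⟨α, hα⟩ := mem_maxIdeal_iff.1 (toLeftRegularQuot_eq_zero_iff.1 h)
  rw [mul_one] at hα
  exact DPow_ne_zero α hα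

theorem toLeftRegularQuot_add_of_mem {s a : algebra K n} (ha : a ∈ maxIdeal K n) :
    toLeftRegularQuot (algebra K n) (s + a) = toLeftRegularQuot (algebra K n) s :=
  map_add_eq_of_map_eq_zero _ (toLeftRegularQuot_eq_zero_iff.2 ha)

theorem DPow_mem_deltaDen (α : Fin n → ℕ) : DPow K α ∈ deltaDen K n :=
  ⟨DPow_mem_delta α, DPow_mem_largestLeftDen α⟩

theorem one_mem_deltaDen : 1 ∈ deltaDen K n := DPow_zero (K := K) (n := n) ▸ DPow_mem_deltaDen 0

/-- Multiplying numerator and denominator of `s⁻¹ r` by one common `∂^(α+β)` brings both into `Δ_n`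
and keeps the denominator in the largest left denominator set. -/
theorem exists_mem_deltaDen_mul_eq (q : LeftRegularQuot (algebra K n)) :
    ∃ t ∈ deltaDen K n, ∃ r ∈ delta K n,
      toLeftRegularQuot (algebra K n) t * q = toLeftRegularQuot (algebra K n) r := by
  obtain ⟨s, hs, r, h⟩ :=
    (isGreatest_largestLeftDen (algebra K n)).1.1.exists_toLoc_mul_eq q
  obtain ⟨α, hα⟩ := exists_DPow_mul_mem_delta s
  obtain ⟨β, hβ⟩ := exists_DPow_mul_mem_delta r
  refine ⟨DPow K (α + β) * s, ⟨?_, mul_mem_largestLeftDen (DPow_mem_largestLeftDen _) hs⟩,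
    DPow K (α + β) * r, ?_, ?_⟩
  · rw [DPow_add, DPow_mul_comm, mul_assoc]
    exact mul_mem (DPow_mem_delta β) hα
  · rw [DPow_add, mul_assoc]
    exact mul_mem (DPow_mem_delta α) hβ
  · rw [map_mul, map_mul, mul_assoc]
    exact congrArg _ h

/-- The multiplicative sets between `deltaDen` and the preimage of the units of the left regular
left quotient ring all have this ring as their localization. -/
theorem exists_mem_leftDen_algebra {T : Set (algebra K n)} (hT : deltaDen K n ⊆ T)
    (mul_mem : ∀ s ∈ T, ∀ t ∈ T, s * t ∈ T)
    (isUnit : ∀ t ∈ T, IsUnit (toLeftRegularQuot (algebra K n) t)) :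
    ∃ h : T ∈ leftDen (algebra K n) (maxIdeal K n),
      IsoUnder h.1.toLoc (toLeftRegularQuot (algebra K n)) := by
  refine exists_mem_leftDen_isoUnder _ (hT one_mem_deltaDen) mul_mem isUnit (fun q => ?_)
    (fun r hr => ?_) fun r => toLeftRegularQuot_eq_zero_iff.symm
  · obtain ⟨t, ht, r, -, h⟩ := exists_mem_deltaDen_mul_eq q
    exact ⟨t, hT ht, r, h⟩
  · obtain ⟨α, hα⟩ := mem_maxIdeal_iff.1 (toLeftRegularQuot_eq_zero_iff.1 hr)
    exact ⟨_, hT (DPow_mem_deltaDen α), hα⟩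

variable (K n) in
/-- The homomorphism from `𝔸_n / 𝔞_n` to the left regular left quotient ring of `𝔸_n`. -/
def factorToQuot : Factor K n →+* LeftRegularQuot (algebra K n) :=
  (maxIdeal K n).ringCon.lift (toLeftRegularQuot (algebra K n)) fun _ _ h =>
    (map_eq_iff_map_sub_eq_zero _).2
      (toLeftRegularQuot_eq_zero_iff.2 ((TwoSidedIdeal.rel_iff _ _ _).1 h))

/-- The kernel of the map to the quotient ring is `𝔞_n`, so `𝔸_n / 𝔞_n` embeds there and the
fractions are the same. -/
theorem exists_mem_leftDen_factor {T : Set (algebra K n)} (hT : deltaDen K n ⊆ T)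
    (mul_mem : ∀ s ∈ T, ∀ t ∈ T, s * t ∈ T)
    (isUnit : ∀ t ∈ T, IsUnit (toLeftRegularQuot (algebra K n) t)) :
    ∃ h : toFactor K n '' T ∈ leftDen (Factor K n) ⊥,
      IsoUnder (h.1.toLoc.comp (toFactor K n)) (toLeftRegularQuot (algebra K n)) := by
  have hinj : Function.Injective (factorToQuot K n) := fun x y h => by
    obtain ⟨a, rfl⟩ := toFactor_surjective x
    obtain ⟨b, rfl⟩ := toFactor_surjective y
    exact toFactor_eq_iff.2 (toLeftRegularQuot_eq_iff.1 h)
  have hmul : ∀ x ∈ toFactor K n '' T, ∀ y ∈ toFactor K n '' T, x * y ∈ toFactor K n '' T := by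
    rintro _ ⟨s, hs, rfl⟩ _ ⟨t, ht, rfl⟩
    exact ⟨s * t, mul_mem s hs t ht, map_mul _ _ _⟩
  obtain ⟨h, e, he⟩ := exists_mem_leftDen_bot_isoUnder (factorToQuot K n) (T := toFactor K n '' T)
    ⟨1, hT one_mem_deltaDen, map_one _⟩ hmul (by
      rintro _ ⟨t, ht, rfl⟩
      exact isUnit t ht)
    (fun q => by
      obtain ⟨t, ht, r, -, h⟩ := exists_mem_deltaDen_mul_eq q
      exact ⟨_, ⟨t, hT ht, rfl⟩, toFactor K n r, h⟩) hinj
  exact ⟨h, e, fun a => he (toFactor K n a)⟩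

theorem exists_mem_leftDen_delta :
    ∃ h : deltaDenIn K n ∈ leftDen (delta K n) ⊥,
      IsoUnder h.1.toLoc ((toLeftRegularQuot (algebra K n)).comp (delta K n).subtype) := by
  refine exists_mem_leftDen_bot_isoUnder _ one_mem_deltaDen
    (fun s hs t ht => mul_mem_deltaDen hs ht) (fun t ht => isUnit_toLeftRegularQuot ht.2)
    (fun q => ?_) fun c d h =>
      Subtype.ext (eq_of_sub_mem_maxIdeal c.2 d.2 (toLeftRegularQuot_eq_iff.1 h))
  obtain ⟨t, ht, r, hr, h⟩ := exists_mem_deltaDen_mul_eq q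
  exact ⟨⟨t, ht.1⟩, ht, ⟨r, hr⟩, h⟩

theorem isUnit_of_mem_add_maxIdeal {T : Set (algebra K n)}
    (isUnit : ∀ t ∈ T, IsUnit (toLeftRegularQuot (algebra K n) t)) :
    ∀ t ∈ T + (maxIdeal K n : Set (algebra K n)),
      IsUnit (toLeftRegularQuot (algebra K n) t) := by
  rintro _ ⟨t, ht, a, ha, rfl⟩
  dsimp only
  rw [toLeftRegularQuot_add_of_mem ha]
  exact isUnit t ht

/-- The left regular elements that become units form a multiplicative set containing `deltaDen`,
hence a left denominator set, which maximality then absorbs. -/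
theorem mem_largestLeftDen_iff {s : algebra K n} : s ∈ largestLeftDen (algebra K n) ↔
    s ∈ leftRegular (algebra K n) ∧ IsUnit (toLeftRegularQuot (algebra K n) s) := by
  have hG := isGreatest_largestLeftDen (algebra K n)
  refine ⟨fun h => ⟨hG.1.2 h, isUnit_toLeftRegularQuot h⟩, fun h => ?_⟩
  obtain ⟨hden, -⟩ := exists_mem_leftDen_algebra
    (T := {s | s ∈ leftRegular (algebra K n) ∧ IsUnit (toLeftRegularQuot (algebra K n) s)})
    (fun t ht => ⟨hG.1.2 ht.2, isUnit_toLeftRegularQuot ht.2⟩)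
    (fun s hs t ht => ⟨fun x hx => hs.1 _ (ht.1 _ (by rw [mul_assoc, hx])), by
      rw [map_mul]; exact hs.2.mul ht.2⟩)
    fun t ht => ht.2
  exact hG.2 ⟨hden.1, fun s hs => hs.1⟩ h

theorem isUnit_of_mem_deltaSat {c : algebra K n} (hc : c ∈ deltaSat K n) :
    IsUnit (toLeftRegularQuot (algebra K n) c) := by
  obtain ⟨-, α, hα⟩ := hc
  have h := isUnit_toLeftRegularQuot hα
  rw [map_mul] at h
  obtain ⟨u, hu⟩ := isUnit_toLeftRegularQuot (DPow_mem_largestLeftDen (K := K) α)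
  rwa [← hu, Units.isUnit_units_mul] at h

/-- With `∂^β c = c' ∂^β` one gets `∂^(α+β) c d = (∂^α c') (∂^β d)`. The first factor lies in the
largest left denominator set because its product with `∂^β` on the right, equal to `∂^β ∂^α c`,
does. -/
theorem mul_mem_deltaSat {c d : algebra K n} (hc : c ∈ deltaSat K n) (hd : d ∈ deltaSat K n) :
    c * d ∈ deltaSat K n := by
  have hcu := isUnit_of_mem_deltaSat hc
  obtain ⟨hc, α, hα⟩ := hc
  obtain ⟨hd, β, hβ⟩ := hd
  refine ⟨mul_mem hc hd, α + β, ?_⟩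
  obtain ⟨c', -, he⟩ := exists_DPow_mul_eq_mul_DPow β hc
  have h1 : DPow K (α + β) * (c * d) = DPow K α * c' * (DPow K β * d) := by
    rw [DPow_add, mul_assoc, ← mul_assoc _ c, he, mul_assoc, mul_assoc]
  have h2 : DPow K α * c' * DPow K β = DPow K β * (DPow K α * c) := by
    rw [mul_assoc, ← he, ← mul_assoc, ← mul_assoc, DPow_mul_comm]
  have h3 : DPow K α * c' * DPow K β ∈ largestLeftDen (algebra K n) := by
    rw [h2]
    exact mul_mem_largestLeftDen (DPow_mem_largestLeftDen β) hα
  rw [h1]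
  -- Left regularity passes from a product to its left factor, and invertibility does too, as `∂^β`
  -- becomes a unit.
  refine mul_mem_largestLeftDen (mem_largestLeftDen_iff.2 ⟨fun x hx => ?_, ?_⟩) hβ
  · exact (mem_largestLeftDen_iff.1 h3).1 x (by rw [← mul_assoc, hx, zero_mul])
  · have h4 := isUnit_toLeftRegularQuot h3
    rw [map_mul] at h4
    obtain ⟨u, hu⟩ := isUnit_toLeftRegularQuot (DPow_mem_largestLeftDen (K := K) β)
    rwa [← hu, Units.isUnit_mul_units] at h4

end Jacobian

end

theorem mainTheorem6 (K : Type*) [Field K] [CharZero K] (n : ℕ) :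
    ((∃ h : Jacobian.deltaDen K n ∈ leftDen (Jacobian.algebra K n) (Jacobian.maxIdeal K n),
        IsoUnder h.1.toLoc (toLeftRegularQuot (Jacobian.algebra K n))) ∧
      IsMultiplicativeSet
        (leftRegular (Jacobian.algebra K n) ∩ (Jacobian.delta K n : Set (Jacobian.algebra K n))) ∧
      IsGreatest
        {T : Set (Jacobian.algebra K n) | IsLeftDenominatorSet T ∧
          T ⊆ leftRegular (Jacobian.algebra K n) ∩
            (Jacobian.delta K n : Set (Jacobian.algebra K n))}
        (Jacobian.deltaDen K n)) ∧
    ((∃ h : Jacobian.deltaDen K n + (Jacobian.maxIdeal K n : Set (Jacobian.algebra K n)) ∈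
          leftDen (Jacobian.algebra K n) (Jacobian.maxIdeal K n),
        IsoUnder h.1.toLoc (toLeftRegularQuot (Jacobian.algebra K n))) ∧
      (∃ h : largestLeftDen (Jacobian.algebra K n) +
            (Jacobian.maxIdeal K n : Set (Jacobian.algebra K n)) ∈
          leftDen (Jacobian.algebra K n) (Jacobian.maxIdeal K n),
        IsoUnder h.1.toLoc (toLeftRegularQuot (Jacobian.algebra K n)))) ∧
    (Set.InjOn (Jacobian.toFactor K n) (Jacobian.delta K n : Set (Jacobian.algebra K n)) ∧
      (∃ h : Jacobian.toFactor K n '' Jacobian.deltaDen K n ∈ leftDen (Jacobian.Factor K n) ⊥,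
        IsoUnder (h.1.toLoc.comp (Jacobian.toFactor K n))
          (toLeftRegularQuot (Jacobian.algebra K n))) ∧
      (∃ h : Jacobian.toFactor K n ''
            (Jacobian.deltaDen K n + (Jacobian.maxIdeal K n : Set (Jacobian.algebra K n))) ∈
          leftDen (Jacobian.Factor K n) ⊥,
        IsoUnder (h.1.toLoc.comp (Jacobian.toFactor K n))
          (toLeftRegularQuot (Jacobian.algebra K n))) ∧
      (∃ h : Jacobian.toFactor K n ''
            (largestLeftDen (Jacobian.algebra K n) +
              (Jacobian.maxIdeal K n : Set (Jacobian.algebra K n))) ∈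
          leftDen (Jacobian.Factor K n) ⊥,
        IsoUnder (h.1.toLoc.comp (Jacobian.toFactor K n))
          (toLeftRegularQuot (Jacobian.algebra K n)))) ∧
    ((∃ h : Jacobian.deltaSat K n ∈ leftDen (Jacobian.algebra K n) (Jacobian.maxIdeal K n),
        IsoUnder h.1.toLoc (toLeftRegularQuot (Jacobian.algebra K n))) ∧
      (∃ h : Jacobian.toFactor K n '' Jacobian.deltaSat K n ∈ leftDen (Jacobian.Factor K n) ⊥,
        IsoUnder (h.1.toLoc.comp (Jacobian.toFactor K n))
          (toLeftRegularQuot (Jacobian.algebra K n)))) ∧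
    (∃ h : Jacobian.deltaSat K n + (Jacobian.maxIdeal K n : Set (Jacobian.algebra K n)) ∈
          leftDen (Jacobian.algebra K n) (Jacobian.maxIdeal K n),
        IsoUnder h.1.toLoc (toLeftRegularQuot (Jacobian.algebra K n))) ∧
    (∃ h : Jacobian.deltaDenIn K n ∈ leftDen (Jacobian.delta K n) ⊥,
        IsoUnder h.1.toLoc
          ((toLeftRegularQuot (Jacobian.algebra K n)).comp
            (Jacobian.delta K n).subtype)) ∧
    ((∃ h : Jacobian.deltaTwo K n ∈ leftDen (Jacobian.algebra K n) (Jacobian.maxIdeal K n),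
        IsoUnder h.1.toLoc (toLeftRegularQuot (Jacobian.algebra K n))) ∧
      Jacobian.deltaDen K n ⊆ Jacobian.deltaTwo K n) := by
  open Jacobian in
  have hG := isGreatest_largestLeftDen (algebra K n)
  have hmulD : ∀ s ∈ deltaDen K n, ∀ t ∈ deltaDen K n, s * t ∈ deltaDen K n :=
    fun s hs t ht => mul_mem_deltaDen hs ht
  have huD : ∀ t ∈ deltaDen K n, IsUnit (toLeftRegularQuot (algebra K n) t) :=
    fun t ht => isUnit_toLeftRegularQuot ht.2
  have hDa := subset_add_maxIdeal (deltaDen K n)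
  have hmulDa := mul_mem_add_maxIdeal hmulD
  have huDa := isUnit_of_mem_add_maxIdeal huD
  have hSa : deltaDen K n ⊆
      largestLeftDen (algebra K n) + (maxIdeal K n : Set (algebra K n)) :=
    fun s hs => subset_add_maxIdeal _ hs.2
  have hmulSa := mul_mem_add_maxIdeal (K := K) (n := n) hG.1.1.mul_mem
  have huSa := isUnit_of_mem_add_maxIdeal (K := K) (n := n) fun _ => isUnit_toLeftRegularQuot
  have hmulC : ∀ s ∈ deltaSat K n, ∀ t ∈ deltaSat K n, s * t ∈ deltaSat K n :=
    fun s hs t ht => mul_mem_deltaSat hs ht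
  have huC : ∀ t ∈ deltaSat K n, IsUnit (toLeftRegularQuot (algebra K n) t) :=
    fun t ht => isUnit_of_mem_deltaSat ht
  have h1 := exists_mem_leftDen_algebra subset_rfl hmulD huD
  refine ⟨⟨h1, ?_, ⟨h1.1.1, fun s hs => ⟨hG.1.2 hs.2, hs.1⟩⟩, fun T hT t ht => ?_⟩,
    ⟨exists_mem_leftDen_algebra hDa hmulDa huDa, exists_mem_leftDen_algebra hSa hmulSa huSa⟩,
    ⟨?_, exists_mem_leftDen_factor subset_rfl hmulD huD,
      exists_mem_leftDen_factor hDa hmulDa huDa, exists_mem_leftDen_factor hSa hmulSa huSa⟩,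
    ⟨exists_mem_leftDen_algebra deltaDen_subset_deltaSat hmulC huC,
      exists_mem_leftDen_factor deltaDen_subset_deltaSat hmulC huC⟩,
    exists_mem_leftDen_algebra (deltaDen_subset_deltaSat.trans (subset_add_maxIdeal _))
      (mul_mem_add_maxIdeal hmulC) (isUnit_of_mem_add_maxIdeal huC),
    exists_mem_leftDen_delta,
    exists_mem_leftDen_algebra deltaDen_subset_deltaTwo mul_mem_deltaTwo
      (isUnit_of_mem_add_maxIdeal fun s hs => isUnit_toLeftRegularQuot hs.1),
    deltaDen_subset_deltaTwo⟩
  · exact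
      { one_mem := ⟨fun x hx => by simpa using hx, one_mem _⟩
        mul_mem := fun s hs t ht =>
          ⟨fun x hx => hs.1 _ (ht.1 _ (by rw [mul_assoc, hx])), mul_mem hs.2 ht.2⟩
        zero_notMem := fun h => one_ne_zero (h.1 (1 : algebra K n) (mul_zero _)) }
  -- A competing set lies in `Δ_n` by assumption and in the largest left denominator set of `𝔸_n` by
  -- maximality.
  · exact ⟨(hT.2 ht).2, hG.2 ⟨hT.1, fun s hs => (hT.2 hs).1⟩ ht⟩
  · exact fun c hc d hd h => eq_of_sub_mem_maxIdeal hc hd (toFactor_eq_iff.1 h)
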